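/- Let $D\subset\mathbb{C}$ be a convex hyperbolic region, that is, a nonempty convex open set whose complement $\mathbb{C}\setminus D$ contains at least two points, and let $f$ be a conformal mapping in $D$, that is, an analytic and univalent (injective) function $f:D\to\mathbb{C}$. Then $$\left|\frac{f''(z)}{f'(z)}\right|\le 8\,\lambda_D(z)\qquad\text{for all } z\in D.$$ Here $\lambda_D$ is the hyperbolic density of $D$, normalized to have curvature $-4$: it is the function on $D$ determined by $$\lambda_D(g(\zeta))\,|g'(\zeta)|=\frac{1}{1-|\zeta|^2},\qquad |\zeta|<1,$$ where $g$ is any analytic covering map of the unit disk $\{\zeta\in\mathbb{C}:|\zeta|<1\}$ onto $D$ (the value of $\lambda_D$ does not depend on the choice of $g$). -/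

import Mathlib

/-- A hyperbolic region: a nonempty connected open subset of the plane whose complement contains
at least two points. -/
structure IsHyperbolicRegion (D : Set ℂ) : Prop where
  isOpen : IsOpen D
  isConnected : IsConnected D
  compl_nontrivial : Dᶜ.Nontrivial

/-- `g` is an analytic covering map of the open unit disk onto `D` (a universal covering, as the
disk is simply connected). Only the values of `g` on the open unit disk matter. -/
structure IsDiskCovering (g : ℂ → ℂ) (D : Set ℂ) : Prop where
  differentiableOn : DifferentiableOn ℂ g (Metric.ball 0 1)
  mapsTo : Set.MapsTo g (Metric.ball 0 1) D
  surjOn : Set.SurjOn g (Metric.ball 0 1) D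
  isCoveringMap : IsCoveringMap (mapsTo.restrict g (Metric.ball 0 1) D)

/-- The hyperbolic density `λ_D` (curvature `-4`): the number `λ_D(w)` determined by
`λ_D(g z) * |g' z| = 1 / (1 - |z|²)` for analytic coverings `g` of `D` by the unit disk and points
`z` of the disk with `g z = w`. For a hyperbolic region `D` and `w ∈ D` this number does not
depend on `g` and `z`, so the set below has exactly one element, and `sInf` extracts it. -/
noncomputable def hyperbolicDensity (D : Set ℂ) (w : ℂ) : ℝ :=
  sInf {r : ℝ | ∃ g : ℂ → ℂ, IsDiskCovering g D ∧ ∃ z ∈ Metric.ball (0 : ℂ) 1, g z = w ∧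
    r * ‖deriv g z‖ = 1 / (1 - ‖z‖ ^ 2)}

/-- `f` is a conformal mapping in `D`: analytic and univalent on `D`. -/
structure IsConformalMappingOn (f : ℂ → ℂ) (D : Set ℂ) : Prop where
  differentiableOn : DifferentiableOn ℂ f D
  injOn : Set.InjOn f D

/-! Let `g` be a covering of `D` by the disk with `g ζ = z`. As `D` is simply connected, `g` is
injective, and precomposing it with a disk automorphism gives a univalent `h` with `h 0 = z` and
`|h'(0)| = |g'(ζ)| (1 - |ζ|²)`, the reciprocal of the density. By the chain rule `(f''/f')(z) h'(0)
= ((f ∘ h)''/(f ∘ h)')(0) - (h''/h')(0)`, and Bieberbach's theorem (`norm_deriv_deriv_le_of_injOn`)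
bounds each term on the right by 4, whence the constant 8.

Bieberbach's theorem follows from the area theorem (`norm_deriv_le_one_of_injOn_inv_add`) for the
reciprocal of the square root transform. The area theorem is proved without boundary curves: the
image of `ε < |z| < r` under `1/z + φ` lies in a nearly optimal ellipse, and its area is the
integral of the Jacobian; then `ε → 0` and `r → 1`.

The density is an infimum over coverings, so one must exist: this is the Riemann mapping theorem
(`exists_isDiskCovering`), by Montel, Hurwitz and Koebe's trick. Convexity supplies simple
connectedness and a half-plane containing `D`. -/

open Filter Set Metric Topology

/-! ### Normal families -/

/-- **Montel's theorem**, in the language of ultrafilters. -/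
theorem exists_tendstoLocallyUniformlyOn_of_norm_le_one {ι : Type*} {U : Set ℂ} (hU : IsOpen U)
    {F : ι → ℂ → ℂ} (hF : ∀ i, DifferentiableOn ℂ (F i) U) (hb : ∀ i, ∀ z ∈ U, ‖F i z‖ ≤ 1)
    (l : Ultrafilter ι) : ∃ f : ℂ → ℂ, TendstoLocallyUniformlyOn F f l U := by
  -- Along an ultrafilter values in a compact disk converge at every point, so no diagonal
  -- subsequence is needed; equicontinuity upgrades this to uniformity on compacta.
  have hlim : ∀ z : ℂ, ∃ w : ℂ, z ∈ U → Tendsto (fun i => F i z) l (𝓝 w) := by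
    intro z
    by_cases hz : z ∈ U
    · obtain ⟨w, -, hw⟩ := (isCompact_closedBall (0 : ℂ) 1).ultrafilter_le_nhds
        (l.map fun i => F i z) (by
          rw [le_principal_iff]
          exact mem_map.2 (univ_mem' fun i => by simpa using hb i z hz))
      exact ⟨w, fun _ => hw⟩
    · exact ⟨0, fun h => absurd h hz⟩
  choose f hf using hlim
  refine ⟨f, (tendstoLocallyUniformlyOn_iff_forall_isCompact hU).2 ?_⟩
  have heq : ∀ x ∈ U, EquicontinuousAt F x := by
    intro x hx
    obtain ⟨R, hR, hRU⟩ := Metric.isOpen_iff.1 hU x hx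
    -- The Schwarz lemma gives a modulus common to all `i`: on the ball of radius `R`, values stay
    -- within 2 of `F i x`.
    refine Metric.equicontinuousAt_of_continuity_modulus (fun z => 2 / R * dist x z) ?_ F ?_
    · have : Continuous fun z : ℂ => 2 / R * dist x z := by fun_prop
      simpa using this.tendsto x
    · filter_upwards [ball_mem_nhds x hR] with z hz i
      rw [dist_comm (F i x), dist_comm x]
      refine Complex.dist_le_div_mul_dist_of_mapsTo_ball ((hF i).mono hRU) (fun y hy => ?_) hz
      rw [mem_closedBall, dist_eq_norm]
      linarith [norm_sub_le (F i y) (F i x), hb i y (hRU hy), hb i x hx]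
  have key := (EquicontinuousOn.tendsto_uniformOnFun_iff_pi' (F := F)
    (𝔖 := {K : Set ℂ | K ⊆ U ∧ IsCompact K}) (fun K hK => hK.2)
    (fun K hK x hx => (heq x (hK.1 hx)).equicontinuousWithinAt K) l f).2 (by
      rw [tendsto_pi_nhds]
      rintro ⟨x, K, hK, hx⟩
      exact hf x (hK.1 hx))
  intro K hKU hK
  exact UniformOnFun.tendsto_iff_tendstoUniformlyOn.1 key K ⟨hKU, hK⟩

/-- **Hurwitz's theorem** on locally uniform limits of univalent functions. -/
theorem injOn_of_tendstoLocallyUniformlyOn {ι : Type*} {l : Filter ι} [l.NeBot]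
    {U : Set ℂ} (hU : IsOpen U) (hUc : IsPreconnected U) {F : ι → ℂ → ℂ} {f : ℂ → ℂ}
    (hF : ∀ i, DifferentiableOn ℂ (F i) U) (hinj : ∀ i, InjOn (F i) U)
    (hlim : TendstoLocallyUniformlyOn F f l U) {z₀ : ℂ} (hz₀ : z₀ ∈ U) (hd : deriv f z₀ ≠ 0) :
    InjOn f U := by
  intro a ha b hb hab
  by_contra hne
  have hfd : DifferentiableOn ℂ f U := hlim.differentiableOn (Eventually.of_forall hF) hU
  have hfa : AnalyticOnNhd ℂ f U := hfd.analyticOnNhd hU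
  have hev : ∀ᶠ z in 𝓝[≠] a, f z ≠ f a := by
    refine ((hfa a ha).eventually_eq_or_eventually_ne analyticAt_const).resolve_left fun h => hd ?_
    have hc := hfa.eqOn_of_preconnected_of_eventuallyEq analyticOnNhd_const hUc ha h
    have : f =ᶠ[𝓝 z₀] fun _ => f a := by
      filter_upwards [hU.mem_nhds hz₀] with z hz using hc hz
    rw [this.deriv_eq, deriv_const]
  rw [eventually_nhdsWithin_iff] at hev
  have hUa : ∀ᶠ z in 𝓝 a, z ∈ U := hU.mem_nhds ha
  have hba : ∀ᶠ z in 𝓝 a, z ≠ b := isOpen_ne.mem_nhds hne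
  obtain ⟨r, hr, hrs⟩ := (nhds_basis_closedBall.mem_iff).1 (hev.and (hUa.and hba))
  have hsph : IsCompact (sphere a r) := isCompact_sphere a r
  have hsub : closedBall a r ⊆ U := fun z hz => (hrs hz).2.1
  obtain ⟨x, hx, hxmin⟩ := hsph.exists_isMinOn (NormedSpace.sphere_nonempty.2 hr.le)
    (f := fun z => ‖f z - f a‖)
    (((hfd.continuousOn.mono hsub).mono sphere_subset_closedBall).sub continuousOn_const).norm
  have hxr : x ≠ a := by
    rintro rfl
    simp [hr.ne] at hx
  set ε := ‖f x - f a‖ with hε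
  have hεpos : 0 < ε :=
    norm_pos_iff.2 (sub_ne_zero.2 ((hrs (sphere_subset_closedBall hx)).1 hxr))
  have hunif := (tendstoLocallyUniformlyOn_iff_forall_isCompact hU).1 hlim _ hsub
    (isCompact_closedBall a r)
  have hbU := hlim.tendsto_at hb
  obtain ⟨i, hi1, hi2⟩ := ((Metric.tendstoUniformlyOn_iff.1 hunif (ε / 16) (by positivity)).and
    (Metric.tendsto_nhds.1 hbU (ε / 16) (by positivity))).exists
  have h1 : ∀ z ∈ closedBall a r, ‖f z - F i z‖ < ε / 16 := fun z hz => by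
    simpa [dist_eq_norm] using hi1 z hz
  have haa := h1 a (mem_closedBall_self hr.le)
  have hbb : ‖F i b - f b‖ < ε / 16 := by simpa [dist_eq_norm] using hi2
  -- The circle is sent at least `ε / 2` away from `F i a`, so the closed disk covers the `ε /
  -- 4`-ball about `F i a`. As `f a = f b`, that ball contains `F i b`, which is then taken in a
  -- disk excluding `b`.
  have hlow : ∀ z ∈ sphere a r, ε / 2 ≤ ‖F i z - F i a‖ := by
    intro z hz
    have h2 := h1 z (sphere_subset_closedBall hz)
    have h3 : ε ≤ ‖f z - f a‖ := hxmin hz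
    have h4 : f z - f a = (f z - F i z) + (F i z - F i a) - (f a - F i a) := by ring
    have h5 := norm_sub_le ((f z - F i z) + (F i z - F i a)) (f a - F i a)
    rw [← h4] at h5
    linarith [norm_add_le (f z - F i z) (F i z - F i a)]
  have hfreq : ∃ᶠ z in 𝓝 a, F i z ≠ F i a := by
    have : ∀ᶠ z in 𝓝[≠] a, F i z ≠ F i a := by
      filter_upwards [self_mem_nhdsWithin, mem_nhdsWithin_of_mem_nhds (hU.mem_nhds ha)]
        with z hz hzU h
      exact hz (hinj i hzU ha h)
    exact this.frequently.filter_mono nhdsWithin_le_nhds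
  have hball := DiffContOnCl.ball_subset_image_closedBall
    (((hF i).mono hsub).diffContOnCl_ball subset_rfl) hr hlow hfreq
  have hmem : F i b ∈ ball (F i a) (ε / 2 / 2) := by
    rw [mem_ball, dist_eq_norm]
    have h4 : F i b - F i a = (F i b - f b) + (f a - F i a) := by rw [hab]; ring
    rw [h4]
    linarith [norm_add_le (F i b - f b) (f a - F i a)]
  obtain ⟨z, hz, hzb⟩ := hball hmem
  have : z = b := hinj i (hsub hz) hb hzb
  exact (hrs hz).2.2 this

/-! ### Automorphisms of the disk -/

/-- The holomorphic automorphism `w ↦ (w - a) / (1 - ā w)` of the unit disk. -/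
noncomputable def diskMobius (a w : ℂ) : ℂ := (w - a) / (1 - (starRingEnd ℂ) a * w)

theorem one_sub_conj_mul_ne_zero {a w : ℂ} (ha : ‖a‖ < 1) (hw : ‖w‖ < 1) :
    1 - (starRingEnd ℂ) a * w ≠ 0 := by
  intro h
  have h1 : ‖(starRingEnd ℂ) a * w‖ = 1 := by rw [← sub_eq_zero.1 h, norm_one]
  rw [norm_mul, RCLike.norm_conj] at h1
  nlinarith [norm_nonneg a, norm_nonneg w]

theorem norm_sq_one_sub_conj_mul (a w : ℂ) :
    ‖1 - (starRingEnd ℂ) a * w‖ ^ 2 = ‖w - a‖ ^ 2 + (1 - ‖a‖ ^ 2) * (1 - ‖w‖ ^ 2) := by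
  simp only [← Complex.normSq_eq_norm_sq, Complex.normSq_apply]
  simp
  ring

theorem one_sub_norm_diskMobius_sq {a w : ℂ} (ha : ‖a‖ < 1) (hw : ‖w‖ < 1) :
    1 - ‖diskMobius a w‖ ^ 2 =
      (1 - ‖a‖ ^ 2) * (1 - ‖w‖ ^ 2) / ‖1 - (starRingEnd ℂ) a * w‖ ^ 2 := by
  have h := norm_ne_zero_iff.2 (one_sub_conj_mul_ne_zero ha hw)
  rw [diskMobius, norm_div, div_pow, eq_div_iff (by positivity), sub_mul,
    div_mul_cancel₀ _ (by positivity), norm_sq_one_sub_conj_mul]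
  ring

theorem norm_diskMobius_lt_one {a w : ℂ} (ha : ‖a‖ < 1) (hw : ‖w‖ < 1) :
    ‖diskMobius a w‖ < 1 := by
  have h := norm_pos_iff.2 (one_sub_conj_mul_ne_zero ha hw)
  have h1 := one_sub_norm_diskMobius_sq ha hw
  have h2 : 0 < 1 - ‖diskMobius a w‖ ^ 2 := by
    rw [h1]
    have : 0 < 1 - ‖a‖ ^ 2 := by nlinarith [norm_nonneg a]
    have : 0 < 1 - ‖w‖ ^ 2 := by nlinarith [norm_nonneg w]
    positivity
  nlinarith [norm_nonneg (diskMobius a w)]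

theorem hasDerivAt_diskMobius {a w : ℂ} (ha : ‖a‖ < 1) (hw : ‖w‖ < 1) :
    HasDerivAt (diskMobius a)
      ((1 - (‖a‖ : ℂ) ^ 2) / (1 - (starRingEnd ℂ) a * w) ^ 2) w := by
  have h := one_sub_conj_mul_ne_zero ha hw
  have h1 : HasDerivAt (fun w : ℂ => w - a) 1 w := (hasDerivAt_id w).sub_const a
  have h2 : HasDerivAt (fun w : ℂ => 1 - (starRingEnd ℂ) a * w) (-((starRingEnd ℂ) a * 1)) w :=
    ((hasDerivAt_id w).const_mul _).const_sub 1
  refine (h1.div h2 h).congr_deriv ?_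
  congr 1
  linear_combination (-1 : ℂ) * Complex.conj_mul' a

theorem diskMobius_neg_diskMobius {a w : ℂ} (ha : ‖a‖ < 1) (hw : ‖w‖ < 1) :
    diskMobius (-a) (diskMobius a w) = w := by
  have h := one_sub_conj_mul_ne_zero ha hw
  have h2 := one_sub_conj_mul_ne_zero (a := -a) (by simpa using ha) (norm_diskMobius_lt_one ha hw)
  have h3 : diskMobius a w * (1 - (starRingEnd ℂ) a * w) = w - a := div_mul_cancel₀ _ h
  rw [diskMobius, div_eq_iff h2, map_neg]
  refine mul_right_cancel₀ h ?_
  linear_combination (1 - (starRingEnd ℂ) a * w) * h3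

theorem injOn_diskMobius {a : ℂ} (ha : ‖a‖ < 1) : InjOn (diskMobius a) (ball 0 1) := by
  intro x hx y hy hxy
  rw [← diskMobius_neg_diskMobius ha (mem_ball_zero_iff.1 hx), hxy,
    diskMobius_neg_diskMobius ha (mem_ball_zero_iff.1 hy)]

theorem diskMobius_eq_zero_iff {a w : ℂ} (ha : ‖a‖ < 1) (hw : ‖w‖ < 1) :
    diskMobius a w = 0 ↔ w = a := by
  simp [diskMobius, one_sub_conj_mul_ne_zero ha hw, sub_eq_zero]

/-! ### The extremal problem behind the Riemann map -/

/-- The family of univalent maps of `D` into the unit disk. -/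
def univalentIntoDisk (D : Set ℂ) : Set (ℂ → ℂ) :=
  {f | DifferentiableOn ℂ f D ∧ MapsTo f D (ball 0 1) ∧ InjOn f D}

theorem not_const_of_deriv_ne_zero {D : Set ℂ} (hDo : IsOpen D) {f : ℂ → ℂ}
    {z₀ : ℂ} (hz₀ : z₀ ∈ D) (hd : deriv f z₀ ≠ 0) : ¬ ∃ w, ∀ z ∈ D, f z = w := by
  rintro ⟨w, hw⟩
  have : f =ᶠ[𝓝 z₀] fun _ => w := by
    filter_upwards [hDo.mem_nhds hz₀] with z hz using hw z hz
  rw [this.deriv_eq, deriv_const] at hd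
  exact hd rfl

/-- The Schwarz lemma bounds the derivatives, and Montel gives a limit of a maximizing sequence. The
competitor `g` forces the limit to have nonzero derivative, so Hurwitz keeps it univalent. -/
theorem exists_maximal_univalentIntoDisk {D : Set ℂ} (hDo : IsOpen D) (hDc : IsPreconnected D)
    {z₀ : ℂ} (hz₀ : z₀ ∈ D) {g : ℂ → ℂ} (hg : g ∈ univalentIntoDisk D) (hgd : deriv g z₀ ≠ 0) :
    ∃ f ∈ univalentIntoDisk D, deriv f z₀ ≠ 0 ∧
      ∀ h ∈ univalentIntoDisk D, ‖deriv h z₀‖ ≤ ‖deriv f z₀‖ := by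
  set V := (fun f => ‖deriv f z₀‖) '' univalentIntoDisk D with hV
  have hVne : V.Nonempty := ⟨_, g, hg, rfl⟩
  have hVb : BddAbove V := by
    obtain ⟨R, hR, hRD⟩ := Metric.isOpen_iff.1 hDo z₀ hz₀
    refine ⟨2 / R, ?_⟩
    rintro _ ⟨f, hf, rfl⟩
    refine Complex.norm_deriv_le_div_of_mapsTo_ball (hf.1.mono hRD) (fun z hz => ?_) hR
    rw [mem_closedBall, dist_eq_norm]
    have h1 := mem_ball_zero_iff.1 (hf.2.1 (hRD hz))
    have h2 := mem_ball_zero_iff.1 (hf.2.1 hz₀)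
    linarith [norm_sub_le (f z) (f z₀)]
  obtain ⟨u, -, hu, huV⟩ := exists_seq_tendsto_sSup hVne hVb
  choose F hFmem hFu using huV
  obtain ⟨f, hf⟩ := exists_tendstoLocallyUniformlyOn_of_norm_le_one hDo (F := F)
    (fun n => (hFmem n).1) (fun n z hz => (mem_ball_zero_iff.1 ((hFmem n).2.1 hz)).le)
    (hyperfilter ℕ)
  have hfd : DifferentiableOn ℂ f D :=
    hf.differentiableOn (Eventually.of_forall fun n => (hFmem n).1) hDo
  have hderiv : Tendsto (fun n => ‖deriv (F n) z₀‖) (hyperfilter ℕ) (𝓝 ‖deriv f z₀‖) :=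
    ((hf.deriv (Eventually.of_forall fun n => (hFmem n).1) hDo).tendsto_at hz₀).norm
  have hsup : ‖deriv f z₀‖ = sSup V := by
    refine tendsto_nhds_unique hderiv ?_
    simp only [hFu]
    exact hu.mono_left Nat.hyperfilter_le_atTop
  have hmax : ∀ h ∈ univalentIntoDisk D, ‖deriv h z₀‖ ≤ ‖deriv f z₀‖ := fun h hh => by
    rw [hsup]
    exact le_csSup hVb ⟨h, hh, rfl⟩
  have hd : deriv f z₀ ≠ 0 := norm_pos_iff.1 ((norm_pos_iff.2 hgd).trans_le (hmax g hg))
  refine ⟨f, ⟨hfd, ?_, injOn_of_tendstoLocallyUniformlyOn hDo hDc (fun n => (hFmem n).1)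
    (fun n => (hFmem n).2.2) hf hz₀ hd⟩, hd, hmax⟩
  -- A priori the limit maps only into the closed disk; its image is open, hence lies in the
  -- interior.
  have hopen : IsOpen (f '' D) :=
    ((hfd.analyticOnNhd hDo).is_constant_or_isOpen hDc).resolve_left
      (not_const_of_deriv_ne_zero hDo hz₀ hd) D subset_rfl hDo
  have hcl : f '' D ⊆ closedBall 0 1 := by
    rintro _ ⟨z, hz, rfl⟩
    refine isClosed_closedBall.mem_of_tendsto (hf.tendsto_at hz) (Eventually.of_forall fun n => ?_)
    exact ball_subset_closedBall ((hFmem n).2.1 hz)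
  have := interior_maximal hcl hopen
  rw [interior_closedBall _ one_ne_zero] at this
  exact fun z hz => this ⟨z, hz, rfl⟩

/-- A univalent map of a simply connected region into the disk whose derivative at a point is
maximal is onto, by Koebe's square root trick. -/
theorem surjOn_of_maximal_univalentIntoDisk {D : Set ℂ} (hDo : IsOpen D)
    (hDc : IsSimplyConnected D) {z₀ : ℂ} (hz₀ : z₀ ∈ D) {f : ℂ → ℂ}
    (hf : f ∈ univalentIntoDisk D) (hd : deriv f z₀ ≠ 0)
    (hmax : ∀ h ∈ univalentIntoDisk D, ‖deriv h z₀‖ ≤ ‖deriv f z₀‖) :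
    SurjOn f D (ball 0 1) := by
  intro a ha
  by_contra hna
  rw [mem_ball_zero_iff] at ha
  have hf1 : ∀ z ∈ D, ‖f z‖ < 1 := fun z hz => mem_ball_zero_iff.1 (hf.2.1 hz)
  have hfd : ∀ z ∈ D, HasDerivAt f (deriv f z) z := fun z hz =>
    (hf.1.differentiableAt (hDo.mem_nhds hz)).hasDerivAt
  -- Since `f` omits `a`, `g` has no zeros and has a square root `s`. Moving `s z₀` to 0 yields a
  -- univalent competitor with strictly larger derivative.
  set g : ℂ → ℂ := fun z => diskMobius a (f z) with hg
  have hgd : ∀ z ∈ D, HasDerivAt g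
      ((1 - (‖a‖ : ℂ) ^ 2) / (1 - (starRingEnd ℂ) a * f z) ^ 2 * deriv f z) z := fun z hz =>
    (hasDerivAt_diskMobius ha (hf1 z hz)).comp z (hfd z hz)
  have hg1 : ∀ z ∈ D, ‖g z‖ < 1 := fun z hz => norm_diskMobius_lt_one ha (hf1 z hz)
  have hg0 : ∀ z ∈ D, g z ≠ 0 := fun z hz h =>
    hna ⟨z, hz, (diskMobius_eq_zero_iff ha (hf1 z hz)).1 h⟩
  obtain ⟨s, hsc, hs⟩ := Complex.exists_continuousOn_pow_eq hDc hDo (g := g)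
    (fun z hz => (hgd z hz).continuousAt.continuousWithinAt)
    (by rintro ⟨z, hz, h⟩; exact hg0 z hz h) two_ne_zero
  have hs0 : ∀ z ∈ D, s z ≠ 0 := fun z hz h => hg0 z hz (by rw [← hs z, h]; simp)
  have hsn : ∀ z, ‖s z‖ ^ 2 = ‖g z‖ := fun z => by rw [← norm_pow, hs]
  have hs1 : ∀ z ∈ D, ‖s z‖ < 1 := fun z hz => by
    have := hg1 z hz
    rw [← hsn] at this
    nlinarith [norm_nonneg (s z)]
  have hsd : ∀ z ∈ D, DifferentiableAt ℂ s z := by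
    intro z hz
    -- A continuous square root is locally a holomorphic inverse of squaring, because `s z ≠ 0`.
    obtain ⟨φ, hφ⟩ : ∃ φ : ℂ → ℂ, HasStrictDerivAt φ ((2 : ℂ) * s z)⁻¹ (g z) ∧
        ∀ᶠ y in 𝓝 z, s y = φ (g y) := by
      have hsq : HasStrictDerivAt (fun w : ℂ => w ^ 2) (2 * s z) (s z) := by
        simpa using hasStrictDerivAt_pow 2 (s z)
      have hne : 2 * s z ≠ 0 := mul_ne_zero two_ne_zero (hs0 z hz)
      refine ⟨hsq.localInverse _ _ _ hne, ?_, ?_⟩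
      · rw [← hs z]
        exact hsq.to_localInverse hne
      · have h1 := hsq.eventually_left_inverse hne
        have h2 : Tendsto s (𝓝 z) (𝓝 (s z)) := (hsc.continuousAt (hDo.mem_nhds hz)).tendsto
        filter_upwards [h2.eventually h1] with y hy
        rw [← hs y]
        exact hy.symm
    exact (hφ.1.hasDerivAt.differentiableAt.comp z (hgd z hz).differentiableAt).congr_of_eventuallyEq
      hφ.2
  set b := s z₀ with hb
  have hb1 : ‖b‖ < 1 := hs1 z₀ hz₀
  have hb0 : 0 < ‖b‖ := norm_pos_iff.2 (hs0 z₀ hz₀)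
  have hkd : ∀ z ∈ D, HasDerivAt (fun z => diskMobius b (s z))
      ((1 - (‖b‖ : ℂ) ^ 2) / (1 - (starRingEnd ℂ) b * s z) ^ 2 * deriv s z) z := fun z hz =>
    (hasDerivAt_diskMobius hb1 (hs1 z hz)).comp z (hsd z hz).hasDerivAt
  have hk : (fun z => diskMobius b (s z)) ∈ univalentIntoDisk D := by
    refine ⟨fun z hz => (hkd z hz).differentiableAt.differentiableWithinAt, fun z hz =>
      mem_ball_zero_iff.2 (norm_diskMobius_lt_one hb1 (hs1 z hz)), fun x hx y hy hxy => ?_⟩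
    have h1 := injOn_diskMobius hb1 (mem_ball_zero_iff.2 (hs1 x hx))
      (mem_ball_zero_iff.2 (hs1 y hy)) hxy
    have h2 : g x = g y := by rw [← hs x, ← hs y, h1]
    exact hf.2.2 hx hy (injOn_diskMobius ha (hf.2.1 hx) (hf.2.1 hy) h2)
  have hle := hmax _ hk
  rw [(hkd z₀ hz₀).deriv, norm_mul, norm_div, norm_pow] at hle
  have hbb : (1 - (starRingEnd ℂ) b * s z₀) = ((1 - ‖b‖ ^ 2 : ℝ) : ℂ) := by
    rw [← hb, Complex.conj_mul']; push_cast; ring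
  have hbb' : (1 - (‖b‖ : ℂ) ^ 2) = ((1 - ‖b‖ ^ 2 : ℝ) : ℂ) := by push_cast; ring
  have hbpos : 0 < 1 - ‖b‖ ^ 2 := by nlinarith
  rw [hbb, hbb', Complex.norm_real, Real.norm_of_nonneg hbpos.le] at hle
  have hsg : 2 * ‖b‖ * ‖deriv s z₀‖ = ‖deriv g z₀‖ := by
    have h1 : HasDerivAt g (2 * s z₀ * deriv s z₀) z₀ := by
      have := (hsd z₀ hz₀).hasDerivAt.pow 2
      refine (this.congr_deriv (by simp)).congr_of_eventuallyEq (Eventually.of_forall fun z => ?_)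
      simp [hs z]
    rw [h1.deriv, norm_mul, norm_mul]
    simp [hb]
  -- Exact up to the factor `1 - ‖f z₀‖² ≤ 1`, which is dropped; `f z₀ = 0` is not assumed.
  have hgp : ‖deriv f z₀‖ * (1 - ‖b‖ ^ 4) ≤ ‖deriv g z₀‖ := by
    have hpos : 0 < 1 - ‖a‖ ^ 2 := by nlinarith [norm_nonneg a]
    have h1 : 1 - ‖b‖ ^ 4 = (1 - ‖a‖ ^ 2) * (1 - ‖f z₀‖ ^ 2) /
        ‖1 - (starRingEnd ℂ) a * f z₀‖ ^ 2 := by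
      rw [← one_sub_norm_diskMobius_sq ha (hf1 z₀ hz₀)]
      have := hsn z₀
      change ‖b‖ ^ 2 = ‖diskMobius a (f z₀)‖ at this
      rw [← this]; ring
    have ha' : (1 - (‖a‖ : ℂ) ^ 2) = ((1 - ‖a‖ ^ 2 : ℝ) : ℂ) := by push_cast; ring
    rw [(hgd z₀ hz₀).deriv, norm_mul, norm_div, norm_pow, ha', Complex.norm_real,
      Real.norm_of_nonneg hpos.le, h1, mul_comm]
    gcongr
    nlinarith [norm_nonneg (f z₀)]
  have hfpos : 0 < ‖deriv f z₀‖ := norm_pos_iff.2 hd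
  have h3 : ‖deriv s z₀‖ ≤ ‖deriv f z₀‖ * (1 - ‖b‖ ^ 2) := by
    have h4 : (1 - ‖b‖ ^ 2) / (1 - ‖b‖ ^ 2) ^ 2 * ‖deriv s z₀‖
        = ‖deriv s z₀‖ / (1 - ‖b‖ ^ 2) := by field_simp
    rw [h4, div_le_iff₀ hbpos] at hle
    exact hle
  have h5 : ‖deriv f z₀‖ * (1 - ‖b‖ ^ 4) ≤ ‖deriv f z₀‖ * (2 * ‖b‖ * (1 - ‖b‖ ^ 2)) := by
    calc _ ≤ 2 * ‖b‖ * ‖deriv s z₀‖ := hgp.trans hsg.ge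
      _ ≤ 2 * ‖b‖ * (‖deriv f z₀‖ * (1 - ‖b‖ ^ 2)) := by gcongr
      _ = _ := by ring
  have h6 := le_of_mul_le_mul_left h5 hfpos
  -- This product is `(1 - ‖b‖⁴) - 2‖b‖(1 - ‖b‖²)`, so it contradicts `h6`.
  have h7 : 0 < (1 - ‖b‖ ^ 2) * (1 - ‖b‖) ^ 2 :=
    mul_pos hbpos (pow_pos (by linarith) 2)
  nlinarith

/-- The open mapping theorem makes `g` continuous, and the inverse function theorem applies off the
zeros of `f'`. These zeros are isolated, so their images are removable singularities; `f'` need not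
be known to be zero-free. -/
theorem differentiableOn_of_leftInverse {D : Set ℂ} (hDo : IsOpen D)
    (hDc : IsPreconnected D) {f g : ℂ → ℂ} (hf : DifferentiableOn ℂ f D)
    {z₀ : ℂ} (hz₀ : z₀ ∈ D) (hd : deriv f z₀ ≠ 0) (hg : ∀ z ∈ D, g (f z) = z) :
    IsOpen (f '' D) ∧ DifferentiableOn ℂ g (f '' D) := by
  have hfa := hf.analyticOnNhd hDo
  have hopen := (hfa.is_constant_or_isOpen hDc).resolve_left
    (not_const_of_deriv_ne_zero hDo hz₀ hd)
  have hO := hopen D subset_rfl hDo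
  have hfg : ∀ w ∈ f '' D, f (g w) = w := by
    rintro _ ⟨z, hz, rfl⟩
    rw [hg z hz]
  have hgc : ∀ w ∈ f '' D, ContinuousAt g w := by
    rintro _ ⟨z, hz, rfl⟩
    rw [ContinuousAt, hg z hz]
    intro s hs
    obtain ⟨t, hts, hto, hzt⟩ := _root_.mem_nhds_iff.1 (inter_mem hs (hDo.mem_nhds hz))
    refine mem_map.2 (mem_of_superset ((hopen t (fun x hx => (hts hx).2) hto).mem_nhds
      ⟨z, hzt, rfl⟩) ?_)
    rintro _ ⟨x, hx, rfl⟩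
    rw [mem_preimage, hg x (hts hx).2]
    exact (hts hx).1
  have hgd : ∀ z ∈ D, deriv f z ≠ 0 → DifferentiableAt ℂ g (f z) := by
    intro z hz hne
    refine (HasStrictDerivAt.of_local_left_inverse (f := f) (f' := deriv f z) (hgc _ ⟨z, hz, rfl⟩)
      ?_ hne ?_).hasDerivAt.differentiableAt
    · rw [hg z hz]
      exact (hfa z hz).hasStrictDerivAt
    · filter_upwards [hO.mem_nhds ⟨z, hz, rfl⟩] with w hw using hfg w hw
  refine ⟨hO, ?_⟩
  rintro w hw
  have hw' := hw
  obtain ⟨z, hz, rfl⟩ := hw'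
  refine (Complex.analyticAt_of_differentiable_on_punctured_nhds_of_continuousAt ?_
    (hgc _ hw)).differentiableAt.differentiableWithinAt
  have hev : ∀ᶠ x in 𝓝[≠] z, deriv f x ≠ 0 := by
    refine ((hfa.deriv z hz).eventually_eq_zero_or_eventually_ne_zero).resolve_left fun h => hd ?_
    exact hfa.deriv.eqOn_zero_of_preconnected_of_eventuallyEq_zero hDc hz h hz₀
  rw [eventually_nhdsWithin_iff] at hev ⊢
  have hgz : Tendsto g (𝓝 (f z)) (𝓝 z) := by
    simpa [ContinuousAt, hg z hz] using hgc _ hw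
  filter_upwards [hgz.eventually hev, hO.mem_nhds hw] with y hy hyD hyne
  obtain ⟨x, hx, rfl⟩ := hyD
  rw [hg x hx] at hy
  exact hgd x hx (hy fun h => hyne (by rw [mem_singleton_iff.1 h]; rfl))

/-! ### Convex regions and their coverings by the disk -/

theorem Convex.isSimplyConnected {D : Set ℂ} (hD : Convex ℝ D) (hne : D.Nonempty) :
    IsSimplyConnected D := by
  have := hD.contractibleSpace hne
  exact (inferInstance : SimplyConnectedSpace D)

theorem Homeomorph.isCoveringMap {X Y : Type*} [TopologicalSpace X] [TopologicalSpace Y]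
    (e : X ≃ₜ Y) : IsCoveringMap e := fun x =>
  IsEvenlyCovered.to_isEvenlyCovered_preimage (I := Unit)
    ⟨inferInstance, univ, mem_univ x, isOpen_univ, isOpen_univ,
      (Homeomorph.Set.univ X).trans (e.trans ((Homeomorph.Set.univ Y).symm.trans
        (Homeomorph.prodUnique _ Unit).symm)), fun _ => rfl⟩

/-- A convex region other than the plane lies in a half-plane, so it has a univalent map into the
disk. -/
theorem Convex.exists_univalentIntoDisk {D : Set ℂ} (hDo : IsOpen D) (hD : Convex ℝ D)
    (hne : D ≠ univ) {z₀ : ℂ} (hz₀ : z₀ ∈ D) : ∃ e ∈ univalentIntoDisk D, deriv e z₀ ≠ 0 := by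
  obtain ⟨a, ha⟩ := (ne_univ_iff_exists_notMem D).1 hne
  obtain ⟨l, hl⟩ := geometric_hahn_banach_open_point hD hDo ha
  -- Chosen so that `l z = Re (c z)`: then `z ↦ c (a - z)` sends `D` into the right half-plane, and
  -- a Cayley transform finishes.
  set c : ℂ := l 1 - l Complex.I * Complex.I with hc
  have hlc : ∀ z : ℂ, (c * z).re = l z := by
    intro z
    have h1 : z = z.re • (1 : ℂ) + z.im • Complex.I := by simp
    conv_rhs => rw [h1]
    rw [map_add, map_smul, map_smul, hc]
    simp
    ring
  have hpos : ∀ z ∈ D, 0 < (c * (a - z)).re := fun z hz => by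
    rw [hlc, map_sub]
    linarith [hl z hz]
  have hne' : ∀ z ∈ D, c * (a - z) + 1 ≠ 0 := fun z hz h => by
    have h1 := hpos z hz
    have h2 := congrArg Complex.re h
    simp only [Complex.add_re, Complex.one_re, Complex.zero_re] at h2
    linarith
  have hc0 : c ≠ 0 := fun h => by
    have := hpos z₀ hz₀
    simp [h] at this
  have hd : ∀ z ∈ D, HasDerivAt (fun z => (c * (a - z) - 1) / (c * (a - z) + 1))
      (-2 * c / (c * (a - z) + 1) ^ 2) z := by
    intro z hz
    have h1 : HasDerivAt (fun z => c * (a - z)) (-c) z := by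
      simpa using ((hasDerivAt_id z).const_sub a).const_mul c
    refine ((h1.sub_const 1).div (h1.add_const 1) (hne' z hz)).congr_deriv ?_
    congr 1
    ring
  refine ⟨fun z => (c * (a - z) - 1) / (c * (a - z) + 1),
    ⟨fun z hz => (hd z hz).differentiableAt.differentiableWithinAt, fun z hz => ?_,
      fun x hx y hy hxy => ?_⟩, ?_⟩
  · rw [mem_ball_zero_iff, norm_div, div_lt_one (norm_pos_iff.2 (hne' z hz)),
      ← sq_lt_sq₀ (norm_nonneg _) (norm_nonneg _)]
    have h1 := hpos z hz
    generalize c * (a - z) = w at h1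
    rw [← Complex.normSq_eq_norm_sq, ← Complex.normSq_eq_norm_sq, Complex.normSq_apply,
      Complex.normSq_apply]
    simp
    nlinarith
  · have h1 := hne' x hx
    have h2 := hne' y hy
    simp only at hxy
    rw [div_eq_div_iff h1 h2] at hxy
    have h3 : c * (x - y) = 0 := by linear_combination (-1 / 2 : ℂ) * hxy
    exact sub_eq_zero.1 ((mul_eq_zero.1 h3).resolve_left hc0)
  · rw [(hd z₀ hz₀).deriv]
    exact div_ne_zero (mul_ne_zero (by norm_num) hc0) (pow_ne_zero 2 (hne' z₀ hz₀))

/-- The **Riemann mapping theorem** for convex regions. -/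
theorem exists_isDiskCovering {D : Set ℂ} (hDo : IsOpen D) (hD : Convex ℝ D)
    (hne : D ≠ univ) {z₀ : ℂ} (hz₀ : z₀ ∈ D) :
    ∃ g : ℂ → ℂ, IsDiskCovering g D ∧ ∃ z ∈ ball (0 : ℂ) 1, g z = z₀ ∧ deriv g z ≠ 0 := by
  have hDc := hD.isSimplyConnected ⟨z₀, hz₀⟩
  have hDp := hD.isPreconnected
  obtain ⟨e, he, hed⟩ := hD.exists_univalentIntoDisk hDo hne hz₀
  obtain ⟨f, hf, hd, hmax⟩ := exists_maximal_univalentIntoDisk hDo hDp hz₀ he hed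
  have hsurj := surjOn_of_maximal_univalentIntoDisk hDo hDc hz₀ hf hd hmax
  have him : f '' D = ball 0 1 := Subset.antisymm hf.2.1.image_subset hsurj
  set g := Function.invFunOn f D with hgdef
  have hgf : ∀ z ∈ D, g (f z) = z := fun z hz => hf.2.2.leftInvOn_invFunOn hz
  have hfg : ∀ w ∈ ball (0 : ℂ) 1, f (g w) = w := fun w hw => hsurj.rightInvOn_invFunOn hw
  have hgD : MapsTo g (ball 0 1) D := hsurj.mapsTo_invFunOn
  obtain ⟨-, hgd⟩ := differentiableOn_of_leftInverse hDo hDp hf.1 hz₀ hd hgf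
  rw [him] at hgd
  refine ⟨g, ⟨hgd, hgD, fun z hz => ⟨f z, hf.2.1 hz, hgf z hz⟩, ?_⟩, f z₀, hf.2.1 hz₀,
    hgf z₀ hz₀, ?_⟩
  · let e : ball (0 : ℂ) 1 ≃ₜ D :=
      { toFun := hgD.restrict g _ _
        invFun := hf.2.1.restrict f _ _
        left_inv := fun w => Subtype.ext (hfg w w.2)
        right_inv := fun z => Subtype.ext (hgf z z.2)
        continuous_toFun := hgd.continuousOn.mapsToRestrict hgD
        continuous_invFun := hf.1.continuousOn.mapsToRestrict hf.2.1 }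
    exact e.isCoveringMap
  · intro h0
    have h1 : HasDerivAt g (deriv g (f z₀)) (f z₀) :=
      (hgd.differentiableAt (isOpen_ball.mem_nhds (hf.2.1 hz₀))).hasDerivAt
    have h2 := h1.comp z₀ (hf.1.differentiableAt (hDo.mem_nhds hz₀)).hasDerivAt
    have h3 : HasDerivAt (g ∘ f) 1 z₀ := (hasDerivAt_id z₀).congr_of_eventuallyEq (by
      filter_upwards [hDo.mem_nhds hz₀] with z hz using hgf z hz)
    have h4 := h2.unique h3
    rw [h0, zero_mul] at h4
    exact zero_ne_one h4

/-- A covering of a simply connected region by the disk is injective. -/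
theorem IsDiskCovering.injOn {g : ℂ → ℂ} {D : Set ℂ} (hg : IsDiskCovering g D) (hDo : IsOpen D)
    (hDc : IsSimplyConnected D) : InjOn g (ball 0 1) := by
  have := hDc.simplyConnectedSpace
  have := hDo.locallyPathConnectedSpace
  have : PreconnectedSpace (ball (0 : ℂ) 1) :=
    isPreconnected_iff_preconnectedSpace.1 (convex_ball (0 : ℂ) 1).isPreconnected
  set p := hg.mapsTo.restrict g (ball 0 1) D with hp
  have hpc : Continuous p := hg.isCoveringMap.continuous
  let e₀ : ball (0 : ℂ) 1 := ⟨0, mem_ball_self one_pos⟩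
  -- Lift the identity of `D` to a section `s`. Both `s ∘ p` and the identity lift `p` and agree at
  -- 0, so they coincide.
  obtain ⟨s, ⟨hs0, hs⟩, -⟩ := hg.isCoveringMap.existsUnique_continuousMap_lifts
    (ContinuousMap.id D) (p e₀) e₀ rfl
  have h1 : s ∘ p = id := by
    refine hg.isCoveringMap.eq_of_comp_eq (s.continuous.comp hpc) continuous_id ?_ e₀ hs0
    rw [← Function.comp_assoc]
    change (p ∘ s) ∘ p = _
    rw [hs]
    rfl
  intro x hx y hy hxy
  have h2 : p ⟨x, hx⟩ = p ⟨y, hy⟩ := Subtype.ext hxy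
  have h3 : s (p ⟨x, hx⟩) = s (p ⟨y, hy⟩) := by rw [h2]
  have h4 := congrFun h1 ⟨x, hx⟩
  have h5 := congrFun h1 ⟨y, hy⟩
  simp only [Function.comp_apply, id] at h4 h5
  rw [h4, h5] at h3
  exact congrArg Subtype.val h3

/-! ### The area theorem -/

/-- The real determinant of `v ↦ a v + c v̄`. -/
theorem Complex.det_of_apply_eq {L : ℂ →L[ℝ] ℂ} {a c : ℂ}
    (hL : ∀ v, L v = a * v + c * (starRingEnd ℂ) v) : L.det = ‖a‖ ^ 2 - ‖c‖ ^ 2 := by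
  rw [ContinuousLinearMap.det, ← LinearMap.det_toMatrix Complex.basisOneI, Matrix.det_fin_two]
  simp only [LinearMap.toMatrix_apply, Complex.coe_basisOneI, Complex.coe_basisOneI_repr,
    ContinuousLinearMap.coe_coe, hL]
  rw [← Complex.normSq_eq_norm_sq, ← Complex.normSq_eq_norm_sq, Complex.normSq_apply,
    Complex.normSq_apply]
  simp
  ring

/-- A lower bound for the mean of `|-1/z² + ψ|²` on a circle, with equality for constant `ψ`. -/
theorem le_circleAverage_norm_sq {ψ : ℂ → ℂ} (hψ : DifferentiableOn ℂ ψ (ball 0 1)) {s : ℝ}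
    (hs0 : 0 < s) (hs1 : s < 1) :
    (s ^ 4)⁻¹ + ‖ψ 0‖ ^ 2 ≤ Real.circleAverage (fun z => ‖-(z ^ 2)⁻¹ + ψ z‖ ^ 2) 0 s := by
  have hsub : closedBall (0 : ℂ) s ⊆ ball 0 1 := closedBall_subset_ball hs1
  set b := ψ 0 with hb
  -- On `|z| = s`, `1/z²` is the conjugate of `c = z²/s⁴`. Expanding the square and using `|ψ|² ≥ 2
  -- Re (b̄ ψ) - |b|²` bounds the integrand below by `Re P`, with `P` holomorphic, so the mean value
  -- property applies.
  set P : ℂ → ℂ := fun z => ((s ^ 4 : ℝ)⁻¹ - ‖b‖ ^ 2 : ℝ) +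
    (2 * (starRingEnd ℂ) b - 2 * (z ^ 2 / (s ^ 4 : ℝ))) * ψ z with hP
  have hPd : DifferentiableOn ℂ P (ball 0 1) := by fun_prop
  have hPc : ContinuousOn P (sphere 0 |s|) := by
    rw [abs_of_pos hs0]
    exact hPd.continuousOn.mono (sphere_subset_closedBall.trans hsub)
  have hmean : Real.circleAverage P 0 s = P 0 := by
    refine DiffContOnCl.circleAverage ((hPd.mono ?_).diffContOnCl_ball subset_rfl)
    rwa [abs_of_pos hs0]
  have hre : Real.circleAverage (fun z => (P z).re) 0 s = (P 0).re := by
    rw [← hmean]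
    exact Complex.reCLM.circleAverage_comp_comm hPc.circleIntegrable'
  have hP0 : (P 0).re = (s ^ 4)⁻¹ + ‖b‖ ^ 2 := by
    have : P 0 = (((s ^ 4)⁻¹ + ‖b‖ ^ 2 : ℝ) : ℂ) := by
      have h := Complex.conj_mul' b
      simp only [hP, ← hb]
      push_cast
      linear_combination 2 * h
    rw [this, Complex.ofReal_re]
  rw [← hP0, ← hre]
  refine Real.circleAverage_mono ?_ ?_ fun z hz => ?_
  · exact (Complex.continuous_re.comp_continuousOn hPc).circleIntegrable'
  · refine ContinuousOn.circleIntegrable' (ContinuousOn.pow (ContinuousOn.norm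
      (ContinuousOn.add (ContinuousOn.neg (ContinuousOn.inv₀ (by fun_prop) fun z hz => ?_))
        (hψ.continuousOn.mono ?_))) 2)
    · refine pow_ne_zero 2 fun h => ?_
      simp [h] at hz
      exact hs0.ne' (abs_eq_zero.1 hz.symm)
    · rw [abs_of_pos hs0]
      exact sphere_subset_closedBall.trans hsub
  · rw [abs_of_pos hs0, mem_sphere_zero_iff_norm] at hz
    have hz0 : z ≠ 0 := by
      rintro rfl
      simp at hz
      exact hs0.ne hz
    set c : ℂ := z ^ 2 / (s ^ 4 : ℝ) with hc
    have h1 : (z ^ 2)⁻¹ = (starRingEnd ℂ) c := by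
      have h2 : (starRingEnd ℂ) z * z = (s : ℂ) ^ 2 := by rw [Complex.conj_mul', hz]
      have h3 : (s : ℂ) ≠ 0 := by exact_mod_cast hs0.ne'
      rw [hc, map_div₀, map_pow, Complex.conj_ofReal]
      push_cast
      rw [inv_eq_one_div, div_eq_div_iff (pow_ne_zero 2 hz0) (pow_ne_zero 4 h3)]
      linear_combination (-((starRingEnd ℂ) z * z) - (s : ℂ) ^ 2) * h2
    have h4 : (s ^ 4)⁻¹ = ‖c‖ ^ 2 := by
      rw [hc, norm_div, norm_pow, hz, Complex.norm_real, Real.norm_of_nonneg (by positivity)]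
      field_simp
    rw [hP]
    simp only
    rw [← hc, h1, h4]
    have h5 : 0 ≤ ‖ψ z - b‖ ^ 2 := by positivity
    simp only [← Complex.normSq_eq_norm_sq, Complex.normSq_apply] at h5 ⊢
    simp at h5 ⊢
    nlinarith

open MeasureTheory in
/-- Integration in polar coordinates of lower bounds for circle averages over an annulus. -/
theorem ofReal_intervalIntegral_le_lintegral_annulus {u : ℂ → ℝ} (hu : Measurable u)
    (hu0 : ∀ z, 0 ≤ u z) {ε r : ℝ} (hε : 0 < ε) (hεr : ε ≤ r) {m : ℝ → ℝ}
    (hm : ContinuousOn m (Icc ε r)) (hm0 : ∀ s ∈ Icc ε r, 0 ≤ m s)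
    (hc : ∀ s ∈ Ioo ε r, ContinuousOn u (sphere 0 s))
    (hle : ∀ s ∈ Ioo ε r, m s ≤ Real.circleAverage u 0 s) :
    ENNReal.ofReal (∫ s in ε..r, s * (2 * Real.pi * m s)) ≤
      ∫⁻ z in {z : ℂ | ε < ‖z‖ ∧ ‖z‖ < r}, ENNReal.ofReal (u z) := by
  have hA : MeasurableSet {z : ℂ | ε < ‖z‖ ∧ ‖z‖ < r} :=
    ((isOpen_lt continuous_const continuous_norm).inter
      (isOpen_lt continuous_norm continuous_const)).measurableSet
  rw [← lintegral_indicator hA, ← Complex.lintegral_comp_polarCoord_symm, polarCoord_target]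
  have hsub : Ioo ε r ×ˢ Ioo (-Real.pi) Real.pi ⊆ Ioi (0 : ℝ) ×ˢ Ioo (-Real.pi) Real.pi :=
    prod_mono (fun s hs => hε.trans hs.1) subset_rfl
  have hsymm : ∀ p : ℝ × ℝ, Complex.polarCoord.symm p = circleMap 0 p.1 p.2 := fun p => by
    rw [Complex.polarCoord_symm_apply, circleMap, zero_add, Complex.exp_mul_I]
    push_cast
    rfl
  have hcm : Measurable fun p : ℝ × ℝ => circleMap 0 p.1 p.2 :=
    Continuous.measurable (by unfold circleMap; fun_prop)
  calc ENNReal.ofReal (∫ s in ε..r, s * (2 * Real.pi * m s))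
      = ∫⁻ s in Ioo ε r, ENNReal.ofReal (s * (2 * Real.pi * m s)) := by
        rw [intervalIntegral.integral_of_le hεr, integral_Ioc_eq_integral_Ioo,
          ofReal_integral_eq_lintegral_ofReal]
        · have : ContinuousOn (fun s => s * (2 * Real.pi * m s)) (Icc ε r) := by fun_prop
          exact (this.integrableOn_Icc).mono_set Ioo_subset_Icc_self
        · filter_upwards [ae_restrict_mem measurableSet_Ioo] with s hs
          have h1 := hm0 s (Ioo_subset_Icc_self hs)
          have h2 := hε.trans hs.1
          have := Real.pi_pos
          simp only [Pi.zero_apply]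
          positivity
    _ ≤ ∫⁻ s in Ioo ε r, ∫⁻ θ in Ioo (-Real.pi) Real.pi,
          ENNReal.ofReal s * ENNReal.ofReal (u (circleMap 0 s θ)) := by
        refine setLIntegral_mono' measurableSet_Ioo fun s hs => ?_
        have hs0 := hε.trans hs.1
        rw [lintegral_const_mul' _ _ ENNReal.ofReal_ne_top, ENNReal.ofReal_mul hs0.le]
        gcongr
        have hcont : Continuous fun θ => u (circleMap 0 s θ) :=
          (hc s hs).comp_continuous (continuous_circleMap 0 s)
            (fun θ => circleMap_mem_sphere 0 hs0.le θ)
        rw [← ofReal_integral_eq_lintegral_ofReal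
          (hcont.continuousOn.integrableOn_Icc.mono_set Ioo_subset_Icc_self)
          (Eventually.of_forall fun θ => hu0 _)]
        refine ENNReal.ofReal_le_ofReal ?_
        rw [← integral_Ioc_eq_integral_Ioo,
          ← intervalIntegral.integral_of_le (by linarith [Real.pi_pos])]
        have hper : Function.Periodic (fun θ => u (circleMap 0 s θ)) (2 * Real.pi) :=
          fun x => by simp [periodic_circleMap 0 s x]
        have h1 := hper.intervalIntegral_add_eq 0 (-Real.pi)
        have h2 := hle s hs
        rw [Real.circleAverage_def, smul_eq_mul, inv_mul_eq_div,
          le_div_iff₀ (by positivity)] at h2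
        rw [zero_add] at h1
        have h3 : -Real.pi + 2 * Real.pi = Real.pi := by ring
        rw [h3] at h1
        rw [← h1]
        linarith
    _ = ∫⁻ p in Ioo ε r ×ˢ Ioo (-Real.pi) Real.pi,
          ENNReal.ofReal p.1 * ENNReal.ofReal (u (circleMap 0 p.1 p.2)) := by
        rw [Measure.volume_eq_prod, setLIntegral_prod]
        exact (measurable_fst.ennreal_ofReal.mul
          (hu.comp hcm).ennreal_ofReal).aemeasurable
    _ = ∫⁻ p in Ioo ε r ×ˢ Ioo (-Real.pi) Real.pi, ENNReal.ofReal p.1 •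
          {z : ℂ | ε < ‖z‖ ∧ ‖z‖ < r}.indicator (fun z => ENNReal.ofReal (u z))
            (Complex.polarCoord.symm p) := by
        refine setLIntegral_congr_fun (measurableSet_Ioo.prod measurableSet_Ioo) fun p hp => ?_
        rw [indicator_of_mem, hsymm, smul_eq_mul]
        rw [hsymm, mem_ofPred_eq, norm_circleMap_zero, abs_of_pos (hε.trans hp.1.1)]
        exact hp.1
    _ ≤ _ := lintegral_mono_set hsub

open MeasureTheory in
/-- The area of the image of an annulus under `z ↦ 1/z + φ z` is bounded below. -/
theorem le_lintegral_norm_sq_annulus {φ : ℂ → ℂ} (hφ : DifferentiableOn ℂ φ (ball 0 1))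
    {ε r : ℝ} (hε : 0 < ε) (hεr : ε ≤ r) (hr : r < 1) :
    ENNReal.ofReal (Real.pi * (((ε ^ 2)⁻¹ - (r ^ 2)⁻¹) + ‖deriv φ 0‖ ^ 2 * (r ^ 2 - ε ^ 2))) ≤
      ∫⁻ z in {z : ℂ | ε < ‖z‖ ∧ ‖z‖ < r}, ENNReal.ofReal (‖-(z ^ 2)⁻¹ + deriv φ z‖ ^ 2) := by
  have hψ : DifferentiableOn ℂ (deriv φ) (ball 0 1) := hφ.deriv isOpen_ball
  set B := ‖deriv φ 0‖ with hB
  have hpos : ∀ s ∈ uIcc ε r, s ≠ 0 := fun s hs => by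
    rw [uIcc_of_le hεr] at hs
    exact (hε.trans_le hs.1).ne'
  have hmc : ContinuousOn (fun s : ℝ => (s ^ 4)⁻¹ + B ^ 2) (uIcc ε r) :=
    ContinuousOn.add (ContinuousOn.inv₀ (by fun_prop) fun s hs => pow_ne_zero 4 (hpos s hs))
      continuousOn_const
  have hint : ∫ s in ε..r, s * (2 * Real.pi * ((s ^ 4)⁻¹ + B ^ 2)) =
      Real.pi * (((ε ^ 2)⁻¹ - (r ^ 2)⁻¹) + B ^ 2 * (r ^ 2 - ε ^ 2)) := by
    rw [intervalIntegral.integral_eq_sub_of_hasDerivAt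
      (f := fun s => Real.pi * (-(s ^ 2)⁻¹ + B ^ 2 * s ^ 2))]
    · ring
    · intro s hs
      have h0 := hpos s hs
      have h1 : HasDerivAt (fun s : ℝ => s ^ 2) (2 * s) s := by simpa using hasDerivAt_pow 2 s
      have h2 := ((h1.inv (pow_ne_zero 2 h0)).neg.add (h1.const_mul (B ^ 2))).const_mul Real.pi
      refine h2.congr_deriv ?_
      field_simp
    · exact (ContinuousOn.mul continuousOn_id (continuousOn_const.mul hmc)).intervalIntegrable
  rw [← hint]
  rw [uIcc_of_le hεr] at hmc
  refine ofReal_intervalIntegral_le_lintegral_annulus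
    (u := fun z => ‖-(z ^ 2)⁻¹ + deriv φ z‖ ^ 2)
    ((((measurable_id.pow_const 2).inv.neg.add (measurable_deriv φ)).norm).pow_const 2)
    (fun z => by positivity) hε hεr hmc (fun s _ => by positivity) (fun s hs => ?_) (fun s hs => ?_)
  · refine ContinuousOn.pow (ContinuousOn.norm (ContinuousOn.add (ContinuousOn.neg
      (ContinuousOn.inv₀ (by fun_prop) fun z hz => pow_ne_zero 2 fun h => ?_))
      (hψ.continuousOn.mono fun z hz => ?_))) 2
    · rw [h, mem_sphere_zero_iff_norm, norm_zero] at hz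
      linarith [hs.1]
    · rw [mem_sphere_zero_iff_norm] at hz
      rw [mem_ball_zero_iff]
      linarith [hs.2]
  · exact le_circleAverage_norm_sq hψ (hε.trans hs.1) (hs.2.trans hr)

/-- First and second order Taylor remainders at 0, with one constant: iterated `dslope`s are bounded
on the compact disk. -/
theorem exists_forall_norm_le_mul_of_norm_le {φ : ℂ → ℂ} (hφ : DifferentiableOn ℂ φ (ball 0 1))
    (h0 : φ 0 = 0) {r : ℝ} (hr : r < 1) : ∃ C, 0 ≤ C ∧ ∀ z : ℂ, ‖z‖ ≤ r →
      ‖φ z‖ ≤ C * ‖z‖ ∧ ‖φ z - deriv φ 0 * z‖ ≤ C * ‖z‖ ^ 2 := by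
  have hnhds : ball (0 : ℂ) 1 ∈ 𝓝 0 := ball_mem_nhds 0 one_pos
  have hk := (Complex.differentiableOn_dslope hnhds).2 hφ
  have hk' := (Complex.differentiableOn_dslope hnhds).2 hk
  have hsub : closedBall (0 : ℂ) r ⊆ ball 0 1 := closedBall_subset_ball hr
  obtain ⟨C₁, hC₁⟩ := (isCompact_closedBall (0 : ℂ) r).exists_bound_of_continuousOn
    (hk.continuousOn.mono hsub)
  obtain ⟨C₂, hC₂⟩ := (isCompact_closedBall (0 : ℂ) r).exists_bound_of_continuousOn
    (hk'.continuousOn.mono hsub)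
  have e1 : ∀ z, φ z = z * dslope φ 0 z := fun z => by
    have := sub_smul_dslope φ 0 z
    simpa [h0] using this.symm
  have e2 : ∀ z, dslope φ 0 z - deriv φ 0 = z * dslope (dslope φ 0) 0 z := fun z => by
    have := sub_smul_dslope (dslope φ 0) 0 z
    simpa using this.symm
  refine ⟨max 0 (max C₁ C₂), le_max_left _ _, fun z hz => ⟨?_, ?_⟩⟩
  · rw [e1, norm_mul, mul_comm]
    gcongr
    exact (hC₁ z (mem_closedBall_zero_iff.2 hz)).trans
      ((le_max_left _ _).trans (le_max_right _ _))
  · have : φ z - deriv φ 0 * z = z ^ 2 * dslope (dslope φ 0) 0 z := by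
      rw [e1]
      linear_combination z * e2 z
    rw [this, norm_mul, norm_pow, mul_comm]
    gcongr
    exact (hC₂ z (mem_closedBall_zero_iff.2 hz)).trans
      ((le_max_right _ _).trans (le_max_right _ _))

/-- `z ↦ 1/z + φ z` maps the annulus into an ellipse of area close to `π / ε²`. -/
theorem norm_sub_conj_le_of_annulus {z p b : ℂ} {ε C : ℝ} (hε : 0 < ε) (hεz : ε ≤ ‖z‖)
    (hz1 : ‖z‖ ≤ 1) (hC : 0 ≤ C) (hεC : 2 * ‖b‖ + 2 * C ≤ ε⁻¹) (h1 : ‖p‖ ≤ C * ‖z‖)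
    (h2 : ‖p - b * z‖ ≤ C * ‖z‖ ^ 2) :
    ‖(z⁻¹ + p) - b * (ε : ℂ) ^ 2 * (starRingEnd ℂ) (z⁻¹ + p)‖ ≤
      ε⁻¹ + (C + ‖b‖ * C) * ε ^ 2 := by
  set s := ‖z‖ with hs
  have hs0 : 0 < s := hε.trans_le hεz
  have hsC : (s : ℂ) ≠ 0 := by exact_mod_cast hs0.ne'
  have hz0 : z ≠ 0 := norm_pos_iff.1 hs0
  have hconj : (starRingEnd ℂ) z⁻¹ = z / (s : ℂ) ^ 2 := by
    have := Complex.conj_mul' z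
    have hcz : (starRingEnd ℂ) z ≠ 0 := by simpa using hz0
    rw [map_inv₀, inv_eq_one_div, div_eq_div_iff hcz (pow_ne_zero 2 hsC)]
    linear_combination -this
  -- Since `conj (1/z) = z/s²`, the correction cancels `b z` exactly at `s = ε`, turning the ellipse
  -- traced by `1/z + b z` into a circle.
  have hdec : (z⁻¹ + p) - b * (ε : ℂ) ^ 2 * (starRingEnd ℂ) (z⁻¹ + p) =
      z⁻¹ + (b * z) * ((1 - ε ^ 2 / s ^ 2 : ℝ) : ℂ) + (p - b * z)
        - b * (ε : ℂ) ^ 2 * (starRingEnd ℂ) p := by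
    rw [map_add, hconj]
    push_cast
    ring
  have hq : 0 ≤ 1 - ε ^ 2 / s ^ 2 := by
    rw [sub_nonneg, div_le_one (by positivity)]
    gcongr
  have n2 : ‖(b * z) * ((1 - ε ^ 2 / s ^ 2 : ℝ) : ℂ)‖ ≤ 2 * ‖b‖ * (s - ε) := by
    rw [norm_mul, norm_mul, Complex.norm_real, Real.norm_of_nonneg hq, ← hs]
    have : s * (1 - ε ^ 2 / s ^ 2) ≤ 2 * (s - ε) := by
      have e : s * (1 - ε ^ 2 / s ^ 2) = (s - ε) * ((s + ε) / s) := by field_simp; ring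
      have e2 : (s + ε) / s ≤ 2 := by rw [div_le_iff₀ hs0]; linarith
      rw [e, mul_comm]
      gcongr
    calc ‖b‖ * s * (1 - ε ^ 2 / s ^ 2) = ‖b‖ * (s * (1 - ε ^ 2 / s ^ 2)) := by ring
      _ ≤ ‖b‖ * (2 * (s - ε)) := by gcongr
      _ = _ := by ring
  have n4 : ‖b * (ε : ℂ) ^ 2 * (starRingEnd ℂ) p‖ ≤ ‖b‖ * C * ε ^ 2 := by
    rw [norm_mul, norm_mul, RCLike.norm_conj, norm_pow, Complex.norm_real,
      Real.norm_of_nonneg hε.le]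
    have : ‖p‖ ≤ C := h1.trans (by nlinarith)
    calc ‖b‖ * ε ^ 2 * ‖p‖ ≤ ‖b‖ * ε ^ 2 * C := by gcongr
      _ = _ := by ring
  -- Away from the inner circle `|1/z|` drops fast enough, by `hεC`, to absorb all errors of order
  -- `s - ε`.
  have n1 : ‖z⁻¹‖ ≤ ε⁻¹ - (s - ε) * (2 * ‖b‖ + 2 * C) := by
    rw [norm_inv, ← hs]
    have e : ε⁻¹ - s⁻¹ = (s - ε) * (s⁻¹ * ε⁻¹) := by field_simp
    have e2 : ε⁻¹ ≤ s⁻¹ * ε⁻¹ := le_mul_of_one_le_left (by positivity) (one_le_inv₀ hs0 |>.2 hz1)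
    have e3 : (s - ε) * (2 * ‖b‖ + 2 * C) ≤ (s - ε) * (s⁻¹ * ε⁻¹) :=
      mul_le_mul_of_nonneg_left (hεC.trans e2) (by linarith)
    linarith
  have n3 : C * s ^ 2 ≤ C * ε ^ 2 + 2 * C * (s - ε) := by
    have : s ^ 2 ≤ ε ^ 2 + 2 * (s - ε) := by nlinarith
    nlinarith
  rw [hdec]
  have t1 := norm_sub_le (z⁻¹ + (b * z) * ((1 - ε ^ 2 / s ^ 2 : ℝ) : ℂ) + (p - b * z))
    (b * (ε : ℂ) ^ 2 * (starRingEnd ℂ) p)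
  have t2 := norm_add_le (z⁻¹ + (b * z) * ((1 - ε ^ 2 / s ^ 2 : ℝ) : ℂ)) (p - b * z)
  have t3 := norm_add_le z⁻¹ ((b * z) * ((1 - ε ^ 2 / s ^ 2 : ℝ) : ℂ))
  nlinarith

open MeasureTheory in
/-- Comparison of the areas of the image of an annulus and of a surrounding ellipse. -/
theorem area_annulus_le {φ : ℂ → ℂ} (hφ : DifferentiableOn ℂ φ (ball 0 1))
    (hinj : InjOn (fun z => z⁻¹ + φ z) (ball 0 1 \ {0})) {ε r C : ℝ} (hε : 0 < ε) (hεr : ε ≤ r)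
    (hr : r < 1) (hC : 0 ≤ C) (hεC : 2 * ‖deriv φ 0‖ + 2 * C ≤ ε⁻¹)
    (hb : ‖deriv φ 0‖ * ε ^ 2 < 1)
    (hbound : ∀ z : ℂ, ‖z‖ ≤ r →
      ‖φ z‖ ≤ C * ‖z‖ ∧ ‖φ z - deriv φ 0 * z‖ ≤ C * ‖z‖ ^ 2) :
    (1 - (‖deriv φ 0‖ * ε ^ 2) ^ 2) *
        (((ε ^ 2)⁻¹ - (r ^ 2)⁻¹) + ‖deriv φ 0‖ ^ 2 * (r ^ 2 - ε ^ 2)) ≤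
      (ε⁻¹ + (C + ‖deriv φ 0‖ * C) * ε ^ 2) ^ 2 := by
  set b := deriv φ 0 with hbdef
  -- A disk of radius `ε⁻¹ + O(ε)` would lose a bounded amount of area, too much. After `w ↦ w - β
  -- w̄`, which scales area by `1 - ‖β‖²`, radius `ε⁻¹ + O(ε²)` suffices.
  set β : ℂ := b * (ε : ℂ) ^ 2 with hβ
  have hβn : ‖β‖ = ‖b‖ * ε ^ 2 := by
    rw [hβ, norm_mul, norm_pow, Complex.norm_real, Real.norm_of_nonneg hε.le]
  set A : Set ℂ := {z : ℂ | ε < ‖z‖ ∧ ‖z‖ < r} with hA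
  have hAm : MeasurableSet A := ((isOpen_lt continuous_const continuous_norm).inter
      (isOpen_lt continuous_norm continuous_const)).measurableSet
  have hA0 : ∀ z ∈ A, z ≠ 0 := fun z hz => norm_pos_iff.1 (hε.trans hz.1)
  have hA1 : A ⊆ ball 0 1 := fun z hz => mem_ball_zero_iff.2 (hz.2.trans hr)
  let T : ℂ →L[ℝ] ℂ := ContinuousLinearMap.id ℝ ℂ -
    ((ContinuousLinearMap.mul ℝ ℂ) β).comp (Complex.conjCLE : ℂ →L[ℝ] ℂ)
  have hT : ∀ w, T w = w - β * (starRingEnd ℂ) w := fun w => by simp [T]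
  have hTinj : Function.Injective T := by
    rw [injective_iff_map_eq_zero]
    intro w hw
    rw [hT, sub_eq_zero] at hw
    by_contra hne
    have h1 : ‖w‖ = ‖β‖ * ‖w‖ := by
      conv_lhs => rw [hw]
      rw [norm_mul, RCLike.norm_conj]
    have h2 : 0 < ‖w‖ := norm_pos_iff.2 hne
    nlinarith
  set G : ℂ → ℂ := fun z => z⁻¹ + φ z with hG
  have hGd : ∀ z ∈ A, HasDerivAt G (-(z ^ 2)⁻¹ + deriv φ z) z := fun z hz =>
    (hasDerivAt_inv (hA0 z hz)).add
      (hφ.differentiableAt (isOpen_ball.mem_nhds (hA1 hz))).hasDerivAt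
  let L : ℂ → ℂ →L[ℝ] ℂ := fun z => T.comp
    ((ContinuousLinearMap.toSpanSingleton ℂ (-(z ^ 2)⁻¹ + deriv φ z)).restrictScalars ℝ)
  have hTG : ∀ z ∈ A, HasFDerivWithinAt (T ∘ G) (L z) A z := fun z hz =>
    (T.hasFDerivAt.comp z ((hGd z hz).hasFDerivAt.restrictScalars ℝ)).hasFDerivWithinAt
  have hdet : ∀ z, |(L z).det| = (1 - ‖β‖ ^ 2) * ‖-(z ^ 2)⁻¹ + deriv φ z‖ ^ 2 := by
    intro z
    rw [Complex.det_of_apply_eq (a := -(z ^ 2)⁻¹ + deriv φ z)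
      (c := -β * (starRingEnd ℂ) (-(z ^ 2)⁻¹ + deriv φ z))]
    · rw [norm_mul, norm_neg, RCLike.norm_conj, abs_of_nonneg]
      · ring
      · have h1 : ‖β‖ ^ 2 ≤ 1 := by
          rw [hβn]
          have : 0 ≤ ‖b‖ * ε ^ 2 := by positivity
          nlinarith
        nlinarith [sq_nonneg ‖-(z ^ 2)⁻¹ + deriv φ z‖]
    · intro v
      simp only [L, ContinuousLinearMap.comp_apply, ContinuousLinearMap.coe_restrictScalars',
        ContinuousLinearMap.toSpanSingleton_apply, smul_eq_mul, hT, map_mul]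
      ring
  have harea := lintegral_abs_det_fderiv_eq_addHaar_image volume hAm hTG
    (hTinj.comp_injOn (hinj.mono (subset_sdiff_singleton hA1 fun h => hA0 0 h rfl)))
  set ρ := ε⁻¹ + (C + ‖b‖ * C) * ε ^ 2 with hρ
  have hρ0 : 0 ≤ ρ := by positivity
  have himg : (T ∘ G) '' A ⊆ closedBall 0 ρ := by
    rintro _ ⟨z, hz, rfl⟩
    rw [mem_closedBall_zero_iff, Function.comp_apply, hT]
    obtain ⟨h1, h2⟩ := hbound z hz.2.le
    exact norm_sub_conj_le_of_annulus hε hz.1.le (hz.2.trans hr).le hC hεC h1 h2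
  have hup := measure_mono (μ := volume) himg
  rw [← harea, Complex.volume_closedBall] at hup
  have hnn : 0 ≤ 1 - ‖β‖ ^ 2 := by
    rw [hβn]
    have : 0 ≤ ‖b‖ * ε ^ 2 := by positivity
    nlinarith
  simp only [hdet, ENNReal.ofReal_mul hnn] at hup
  rw [lintegral_const_mul' _ _ ENNReal.ofReal_ne_top] at hup
  have hlow := mul_le_mul_right (le_lintegral_norm_sq_annulus hφ hε hεr hr)
    (ENNReal.ofReal (1 - ‖β‖ ^ 2))
  have h3 := hlow.trans hup
  have hpi : ((NNReal.pi : NNReal) : ENNReal) = ENNReal.ofReal Real.pi := by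
    rw [ENNReal.ofReal, ← NNReal.coe_real_pi, Real.toNNReal_coe]
  rw [← ENNReal.ofReal_mul hnn, hpi, ← ENNReal.ofReal_pow hρ0,
    ← ENNReal.ofReal_mul (by positivity), ENNReal.ofReal_le_ofReal_iff (by positivity), hβn] at h3
  have := Real.pi_pos
  refine le_of_mul_le_mul_left ?_ this
  linarith

/-- **Gronwall's area theorem**, first coefficient. -/
theorem norm_deriv_le_one_of_injOn_inv_add {φ : ℂ → ℂ} (hφ : DifferentiableOn ℂ φ (ball 0 1))
    (h0 : φ 0 = 0) (hinj : InjOn (fun z => z⁻¹ + φ z) (ball 0 1 \ {0})) : ‖deriv φ 0‖ ≤ 1 := by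
  set B := ‖deriv φ 0‖ with hB
  have hB0 : 0 ≤ B := norm_nonneg _
  have key : ∀ r ∈ Ioo (0 : ℝ) 1, B * r ^ 2 ≤ 1 := by
    rintro r ⟨hr0, hr1⟩
    obtain ⟨C, hC, hbound⟩ := exists_forall_norm_le_mul_of_norm_le hφ h0 hr1
    set D := C + B * C with hD
    -- The terms `ε⁻²` of the two areas cancel; everything on the right vanishes as `ε → 0`.
    have hev : ∀ᶠ ε in 𝓝[>] (0 : ℝ), B ^ 2 * r ^ 2 - (r ^ 2)⁻¹ ≤
        2 * D * ε + D ^ 2 * ε ^ 4 + 2 * B ^ 2 * ε ^ 2 - B ^ 2 * (r ^ 2)⁻¹ * ε ^ 4 +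
          B ^ 4 * r ^ 2 * ε ^ 4 - B ^ 4 * ε ^ 6 := by
      have e1 : ∀ᶠ ε in 𝓝[>] (0 : ℝ), 2 * B + 2 * C ≤ ε⁻¹ :=
        tendsto_inv_nhdsGT_zero.eventually_ge_atTop _
      have e2 : ∀ᶠ ε in 𝓝[>] (0 : ℝ), B * ε ^ 2 < 1 := by
        have : Continuous fun ε : ℝ => B * ε ^ 2 := by fun_prop
        exact ((this.tendsto 0).mono_left nhdsWithin_le_nhds).eventually
          (gt_mem_nhds (by simp))
      have e3 : ∀ᶠ ε in 𝓝[>] (0 : ℝ), ε < r :=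
        nhdsWithin_le_nhds (gt_mem_nhds hr0)
      filter_upwards [e1, e2, e3, self_mem_nhdsWithin] with ε h1 h2 h3 hε
      have hε : 0 < ε := hε
      have h := area_annulus_le hφ hinj hε h3.le hr1 hC h1 h2 hbound
      rw [← hB, ← hD] at h
      have l : (1 - (B * ε ^ 2) ^ 2) * (((ε ^ 2)⁻¹ - (r ^ 2)⁻¹) + B ^ 2 * (r ^ 2 - ε ^ 2)) =
          (ε ^ 2)⁻¹ - (r ^ 2)⁻¹ + B ^ 2 * r ^ 2 - 2 * B ^ 2 * ε ^ 2 + B ^ 2 * (r ^ 2)⁻¹ * ε ^ 4 -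
            B ^ 4 * r ^ 2 * ε ^ 4 + B ^ 4 * ε ^ 6 := by
        field_simp
        ring
      have l2 : (ε⁻¹ + D * ε ^ 2) ^ 2 = (ε ^ 2)⁻¹ + 2 * D * ε + D ^ 2 * ε ^ 4 := by
        field_simp
        ring
      rw [l, l2] at h
      linarith
    have hlim : Tendsto (fun ε : ℝ => 2 * D * ε + D ^ 2 * ε ^ 4 + 2 * B ^ 2 * ε ^ 2 -
        B ^ 2 * (r ^ 2)⁻¹ * ε ^ 4 + B ^ 4 * r ^ 2 * ε ^ 4 - B ^ 4 * ε ^ 6) (𝓝[>] 0) (𝓝 0) := by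
      have : Continuous fun ε : ℝ => 2 * D * ε + D ^ 2 * ε ^ 4 + 2 * B ^ 2 * ε ^ 2 -
        B ^ 2 * (r ^ 2)⁻¹ * ε ^ 4 + B ^ 4 * r ^ 2 * ε ^ 4 - B ^ 4 * ε ^ 6 := by fun_prop
      simpa using (this.tendsto 0).mono_left (nhdsWithin_le_nhds (s := Ioi 0))
    have h := ge_of_tendsto hlim hev
    have h4 : B ^ 2 * r ^ 2 ≤ (r ^ 2)⁻¹ := by linarith
    rw [← one_div, le_div_iff₀ (by positivity)] at h4
    have h5 : (B * r ^ 2) ^ 2 ≤ 1 := by linarith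
    have h6 : 0 ≤ B * r ^ 2 := by positivity
    nlinarith
  have hlim : Tendsto (fun r : ℝ => B * r ^ 2) (𝓝[<] 1) (𝓝 B) := by
    have : Continuous fun r : ℝ => B * r ^ 2 := by fun_prop
    simpa using (this.tendsto 1).mono_left (nhdsWithin_le_nhds (s := Iio 1))
  refine le_of_tendsto hlim ?_
  filter_upwards [Ioo_mem_nhdsLT (zero_lt_one (α := ℝ))] with r hr using key r hr

/-! ### The second coefficient -/

/-- A nonvanishing holomorphic function on the unit disk with value `1` at the origin has a
holomorphic inverse square root. -/
theorem exists_inv_sqrt_of_ne_zero {p : ℂ → ℂ} (hp : DifferentiableOn ℂ p (ball 0 1))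
    (hp0 : ∀ z ∈ ball (0 : ℂ) 1, p z ≠ 0) (h1 : p 0 = 1) :
    ∃ q : ℂ → ℂ, DifferentiableOn ℂ q (ball 0 1) ∧ q 0 = 1 ∧
      ∀ z ∈ ball (0 : ℂ) 1, q z ^ 2 * p z = 1 := by
  have hmem : (0 : ℂ) ∈ ball (0 : ℂ) 1 := mem_ball_self one_pos
  have hlog : DifferentiableOn ℂ (fun z => deriv p z / p z) (ball 0 1) :=
    (hp.deriv isOpen_ball).div hp hp0
  obtain ⟨l, hl0, hl⟩ := hlog.isExactOn_ball.with_val_at 0 0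
  have hpd : ∀ z ∈ ball (0 : ℂ) 1, HasDerivAt p (deriv p z) z := fun z hz =>
    (hp.differentiableAt (isOpen_ball.mem_nhds hz)).hasDerivAt
  have hE : ∀ z ∈ ball (0 : ℂ) 1, HasDerivAt (fun z => Complex.exp (-l z) * p z) 0 z := by
    intro z hz
    refine (((hl z hz).neg.cexp).mul (hpd z hz)).congr_deriv ?_
    have := hp0 z hz
    simp only [Pi.neg_apply]
    field_simp
    ring
  have hconst : ∀ z ∈ ball (0 : ℂ) 1, Complex.exp (-l z) * p z = 1 := by
    intro z hz
    have := (convex_ball (0 : ℂ) 1).is_const_of_fderivWithin_eq_zero (𝕜 := ℂ)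
      (f := fun z => Complex.exp (-l z) * p z)
      (fun z hz => (hE z hz).differentiableAt.differentiableWithinAt)
      (fun z hz => by
        rw [fderivWithin_of_isOpen isOpen_ball hz, (hE z hz).hasFDerivAt.fderiv]
        ext
        simp) hz hmem
    simpa [hl0, h1] using this
  refine ⟨fun z => Complex.exp (-l z / 2), fun z hz =>
    ((hl z hz).neg.div_const 2).cexp.differentiableAt.differentiableWithinAt, by simp [hl0],
    fun z hz => ?_⟩
  rw [← hconst z hz, ← Complex.exp_nat_mul]
  congr 2
  push_cast
  ring

/-- Write `f = f 0 + z k` with `k = dslope f 0` and differentiate twice: `k'(0)` is the second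
Taylor coefficient. -/
theorem deriv_dslope_self {f : ℂ → ℂ} {U : Set ℂ} (hU : U ∈ 𝓝 (0 : ℂ))
    (hf : DifferentiableOn ℂ f U) : 2 * deriv (dslope f 0) 0 = deriv (deriv f) 0 := by
  have hk : DifferentiableOn ℂ (dslope f 0) U := (Complex.differentiableOn_dslope hU).2 hf
  have hka : AnalyticAt ℂ (dslope f 0) 0 := hk.analyticAt hU
  have hev : deriv f =ᶠ[𝓝 0] fun z => dslope f 0 z + z * deriv (dslope f 0) z := by
    filter_upwards [hka.eventually_analyticAt] with z hz
    have h1 : HasDerivAt (fun z => f 0 + z * dslope f 0 z)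
        (1 * dslope f 0 z + z * deriv (dslope f 0) z) z :=
      ((hasDerivAt_id z).mul hz.differentiableAt.hasDerivAt).const_add _
    have h2 : f = fun z => f 0 + z * dslope f 0 z := by
      ext z
      have := sub_smul_dslope f 0 z
      simp only [sub_zero, smul_eq_mul] at this
      rw [this]
      ring
    rw [one_mul] at h1
    rw [← h2] at h1
    exact h1.deriv
  rw [hev.deriv_eq]
  have h3 := hka.differentiableAt.hasDerivAt.add
    ((hasDerivAt_id (0 : ℂ)).mul hka.deriv.differentiableAt.hasDerivAt)
  rw [show (fun z => dslope f 0 z + z * deriv (dslope f 0) z) =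
    dslope f 0 + id * deriv (dslope f 0) from rfl, h3.deriv]
  simp
  ring

/-- **Bieberbach's theorem** on the second coefficient of a univalent function. -/
theorem norm_deriv_deriv_le_of_injOn {f : ℂ → ℂ} (hf : DifferentiableOn ℂ f (ball 0 1))
    (hinj : InjOn f (ball 0 1)) (hd : deriv f 0 ≠ 0) :
    ‖deriv (deriv f) 0 / deriv f 0‖ ≤ 4 := by
  have hmem : (0 : ℂ) ∈ ball (0 : ℂ) 1 := mem_ball_self one_pos
  have hnhds : ball (0 : ℂ) 1 ∈ 𝓝 0 := ball_mem_nhds 0 one_pos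
  set p : ℂ → ℂ := fun z => dslope f 0 z / deriv f 0 with hp
  have hkd : DifferentiableOn ℂ (dslope f 0) (ball 0 1) :=
    (Complex.differentiableOn_dslope hnhds).2 hf
  have hpd : DifferentiableOn ℂ p (ball 0 1) := hkd.div_const _
  have hfp : ∀ z, f z - f 0 = z * (deriv f 0 * p z) := fun z => by
    have := sub_smul_dslope f 0 z
    simp only [sub_zero, smul_eq_mul] at this
    rw [← this, hp]
    field_simp
  have hp1 : p 0 = 1 := by simp [hp, hd]
  have hp0 : ∀ z ∈ ball (0 : ℂ) 1, p z ≠ 0 := by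
    intro z hz h
    have h1 : f z = f 0 := sub_eq_zero.1 (by rw [hfp, h]; simp)
    rw [hinj hz hmem h1, hp1] at h
    exact one_ne_zero h
  obtain ⟨q, hqd, hq1, hq⟩ := exists_inv_sqrt_of_ne_zero hpd hp0 hp1
  have hqa : HasDerivAt q (deriv q 0) 0 := (hqd.differentiableAt hnhds).hasDerivAt
  have hpa : HasDerivAt p (deriv p 0) 0 := (hpd.differentiableAt hnhds).hasDerivAt
  have hqp : 2 * deriv q 0 + deriv p 0 = 0 := by
    have h1 := (hqa.pow 2).mul hpa
    have h2 : HasDerivAt (q ^ 2 * p) 0 0 :=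
      (hasDerivAt_const (0 : ℂ) (1 : ℂ)).congr_of_eventuallyEq (by
        filter_upwards [hnhds] with z hz using by simpa using hq z hz)
    have h3 := h1.unique h2
    simpa [hq1, hp1] using h3
  have hsq : ∀ z ∈ ball (0 : ℂ) 1, z ^ 2 ∈ ball (0 : ℂ) 1 := fun z hz => by
    rw [mem_ball_zero_iff] at hz ⊢
    rw [norm_pow]
    nlinarith [norm_nonneg z]
  -- With `q = p^(-1/2)`, `q(z²)/z = 1/z + φ z` is the reciprocal of the square root transform of
  -- the normalized `f`, and `φ'(0) = q'(0) = -p'(0)/2`.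
  set φ : ℂ → ℂ := fun z => z * dslope q 0 (z ^ 2) with hφ
  have hqs : DifferentiableOn ℂ (dslope q 0) (ball 0 1) :=
    (Complex.differentiableOn_dslope hnhds).2 hqd
  have hqs2 : DifferentiableOn ℂ (fun z => dslope q 0 (z ^ 2)) (ball 0 1) :=
    hqs.comp (by fun_prop) hsq
  have hφd : DifferentiableOn ℂ φ (ball 0 1) := differentiableOn_id.mul hqs2
  have hφ' : deriv φ 0 = deriv q 0 := by
    have h1 := (hasDerivAt_id (0 : ℂ)).mul (hqs2.differentiableAt hnhds).hasDerivAt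
    have h2 : deriv φ 0 = _ := h1.deriv
    rw [h2]
    simp
  have hG : ∀ z : ℂ, z ≠ 0 → z⁻¹ + φ z = q (z ^ 2) / z := fun z hz => by
    have := sub_smul_dslope q 0 (z ^ 2)
    simp only [sub_zero, smul_eq_mul, hq1] at this
    rw [hφ]
    field_simp
    linear_combination this
  have hq0 : ∀ z ∈ ball (0 : ℂ) 1, q z ≠ 0 := fun z hz h => by
    have := hq z hz
    rw [h] at this
    simp at this
  have hGinj : InjOn (fun z => z⁻¹ + φ z) (ball 0 1 \ {0}) := by
    rintro x ⟨hx, hx0⟩ y ⟨hy, hy0⟩ hxy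
    rw [mem_singleton_iff] at hx0 hy0
    simp only [hG x hx0, hG y hy0] at hxy
    have h2 : x ^ 2 = y ^ 2 := by
      refine hinj (hsq x hx) (hsq y hy) ?_
      have h3 : f (x ^ 2) - f 0 = f (y ^ 2) - f 0 := by
        rw [hfp, hfp]
        have ex := hq _ (hsq x hx)
        have ey := hq _ (hsq y hy)
        have h4 : (q (x ^ 2) / x) ^ 2 = (q (y ^ 2) / y) ^ 2 := by rw [hxy]
        rw [div_pow, div_pow, div_eq_div_iff (pow_ne_zero 2 hx0) (pow_ne_zero 2 hy0)] at h4
        linear_combination (-deriv f 0 * p (x ^ 2) * p (y ^ 2)) * h4 -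
          (deriv f 0 * x ^ 2 * p (x ^ 2)) * ey + (deriv f 0 * y ^ 2 * p (y ^ 2)) * ex
      linear_combination h3
    -- The function `q(z²)/z` is odd and never 0, which excludes `x = -y`.
    rcases sq_eq_sq_iff_eq_or_eq_neg.1 h2 with h | h
    · exact h
    · exfalso
      rw [h2, h, div_neg, neg_eq_iff_add_eq_zero, ← two_mul, mul_eq_zero] at hxy
      exact div_ne_zero (hq0 _ (hsq y hy)) hy0 (hxy.resolve_left two_ne_zero)
  have hone := norm_deriv_le_one_of_injOn_inv_add hφd (by simp [hφ]) hGinj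
  rw [hφ'] at hone
  have hpder : deriv p 0 = deriv (dslope f 0) 0 / deriv f 0 := deriv_div_const _
  have hfin : deriv (deriv f) 0 / deriv f 0 = -4 * deriv q 0 := by
    rw [← deriv_dslope_self hnhds hf]
    rw [hpder] at hqp
    linear_combination 2 * hqp
  rw [hfin, norm_mul]
  norm_num
  linarith

/-! ### The pre-Schwarzian and the density -/

/-- The pre-Schwarzian of a composition. -/
theorem deriv_deriv_comp_div {f h : ℂ → ℂ} {D U : Set ℂ} (hD : IsOpen D) (hU : IsOpen U)
    (hf : DifferentiableOn ℂ f D) (hh : DifferentiableOn ℂ h U) (hm : MapsTo h U D) {z : ℂ}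
    (hz : z ∈ U) (hfz : deriv f (h z) ≠ 0) (hhz : deriv h z ≠ 0) :
    deriv (f ∘ h) z = deriv f (h z) * deriv h z ∧
    deriv (deriv (f ∘ h)) z / deriv (f ∘ h) z =
      deriv (deriv f) (h z) / deriv f (h z) * deriv h z + deriv (deriv h) z / deriv h z := by
  have hfd : ∀ w ∈ D, HasDerivAt f (deriv f w) w := fun w hw =>
    (hf.differentiableAt (hD.mem_nhds hw)).hasDerivAt
  have hhd : ∀ w ∈ U, HasDerivAt h (deriv h w) w := fun w hw =>
    (hh.differentiableAt (hU.mem_nhds hw)).hasDerivAt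
  have h1 : ∀ w ∈ U, deriv (f ∘ h) w = deriv f (h w) * deriv h w := fun w hw =>
    ((hfd _ (hm hw)).comp w (hhd w hw)).deriv
  have hf2 : HasDerivAt (deriv f) (deriv (deriv f) (h z)) (h z) :=
    ((hf.deriv hD).differentiableAt (hD.mem_nhds (hm hz))).hasDerivAt
  have hh2 : HasDerivAt (deriv h) (deriv (deriv h) z) z :=
    ((hh.deriv hU).differentiableAt (hU.mem_nhds hz)).hasDerivAt
  have h2 : HasDerivAt (deriv (f ∘ h))
      (deriv (deriv f) (h z) * deriv h z * deriv h z + deriv f (h z) * deriv (deriv h) z) z :=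
    ((hf2.comp z (hhd z hz)).mul hh2).congr_of_eventuallyEq (by
      filter_upwards [hU.mem_nhds hz] with w hw using h1 w hw)
  refine ⟨h1 z hz, ?_⟩
  rw [h2.deriv, h1 z hz]
  field_simp

/-- The pre-Schwarzian bound at the image of the origin under a univalent map of the disk. -/
theorem norm_deriv_deriv_div_mul_le {f h : ℂ → ℂ} {D : Set ℂ} (hD : IsOpen D)
    (hf : IsConformalMappingOn f D) (hh : DifferentiableOn ℂ h (ball 0 1))
    (hm : MapsTo h (ball 0 1) D) (hinj : InjOn h (ball 0 1)) (hhd : deriv h 0 ≠ 0)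
    (hfd : deriv f (h 0) ≠ 0) :
    ‖deriv (deriv f) (h 0) / deriv f (h 0)‖ * ‖deriv h 0‖ ≤ 8 := by
  obtain ⟨h1, h2⟩ := deriv_deriv_comp_div hD isOpen_ball hf.differentiableOn hh hm
    (mem_ball_self one_pos) hfd hhd
  have b1 := norm_deriv_deriv_le_of_injOn hh hinj hhd
  have b2 := norm_deriv_deriv_le_of_injOn (f := f ∘ h) (hf.differentiableOn.comp hh hm)
    (hf.injOn.comp hinj hm) (by rw [h1]; exact mul_ne_zero hfd hhd)
  rw [← norm_mul, eq_sub_of_add_eq h2.symm]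
  linarith [norm_sub_le (deriv (deriv (f ∘ h)) 0 / deriv (f ∘ h) 0) (deriv (deriv h) 0 / deriv h 0)]

theorem corollary4p4 (D : Set ℂ) (hD : IsHyperbolicRegion D) (hconv : Convex ℝ D)
    (f : ℂ → ℂ) (hf : IsConformalMappingOn f D) (z : ℂ) (hz : z ∈ D) :
    ‖deriv (deriv f) z / deriv f z‖ ≤ 8 * hyperbolicDensity D z := by
  have hDo := hD.isOpen
  have hne : D ≠ univ := by
    rintro rfl
    simpa using hD.compl_nontrivial.nonempty
  have hDc := hconv.isSimplyConnected ⟨z, hz⟩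
  have hbelow : ‖deriv (deriv f) z / deriv f z‖ / 8 ≤ hyperbolicDensity D z := by
    -- Nonemptiness matters because `sInf ∅ = 0`; this is where the Riemann map is used.
    refine le_csInf ?_ ?_
    · obtain ⟨g, hg, ζ, hζ, hgζ, hgd⟩ := exists_isDiskCovering hDo hconv hne hz
      exact ⟨1 / (1 - ‖ζ‖ ^ 2) / ‖deriv g ζ‖, g, hg, ζ, hζ, hgζ,
        div_mul_cancel₀ _ (norm_ne_zero_iff.2 hgd)⟩
    · rintro r ⟨g, hg, ζ, hζ, rfl, hr⟩
      have hζ1 := mem_ball_zero_iff.1 hζ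
      have hpos : 0 < 1 - ‖ζ‖ ^ 2 := by nlinarith [norm_nonneg ζ]
      have hrpos : 0 < r * ‖deriv g ζ‖ := by rw [hr]; positivity
      have hgd : deriv g ζ ≠ 0 := by
        intro h
        simp [h] at hrpos
      have hr0 : 0 < r := pos_of_mul_pos_left hrpos (norm_nonneg _)
      -- Here the quotient is 0 by the convention for division by zero, so nonvanishing of `f'` need
      -- not be proved.
      by_cases hfd : deriv f (g ζ) = 0
      · simp [hfd, hr0.le]
      have hnζ : ‖-ζ‖ < 1 := by rwa [norm_neg]
      have hM0 : diskMobius (-ζ) 0 = ζ := by simp [diskMobius]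
      have hMm : MapsTo (diskMobius (-ζ)) (ball 0 1) (ball 0 1) := fun w hw =>
        mem_ball_zero_iff.2 (norm_diskMobius_lt_one hnζ (mem_ball_zero_iff.1 hw))
      have hMd : DifferentiableOn ℂ (diskMobius (-ζ)) (ball 0 1) := fun w hw =>
        (hasDerivAt_diskMobius hnζ (mem_ball_zero_iff.1 hw)).differentiableAt.differentiableWithinAt
      have hM' : HasDerivAt (diskMobius (-ζ)) (((1 - ‖ζ‖ ^ 2 : ℝ) : ℂ)) 0 := by
        simpa using hasDerivAt_diskMobius hnζ (w := 0) (by simp)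
      have hh' : deriv (g ∘ diskMobius (-ζ)) 0 = deriv g ζ * ((1 - ‖ζ‖ ^ 2 : ℝ) : ℂ) := by
        have h1 : HasDerivAt g (deriv g ζ) (diskMobius (-ζ) 0) := by
          rw [hM0]
          exact (hg.differentiableOn.differentiableAt (isOpen_ball.mem_nhds hζ)).hasDerivAt
        exact (h1.comp 0 hM').deriv
      have hh0 : (g ∘ diskMobius (-ζ)) 0 = g ζ := by simp [hM0]
      have hmain := norm_deriv_deriv_div_mul_le (h := g ∘ diskMobius (-ζ)) hDo hf
        (hg.differentiableOn.comp hMd hMm) (hg.mapsTo.comp hMm)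
        ((hg.injOn hDo hDc).comp (injOn_diskMobius hnζ) hMm)
        (by rw [hh']; exact mul_ne_zero hgd (by exact_mod_cast hpos.ne')) (by rwa [hh0])
      rw [hh0, hh', norm_mul, Complex.norm_real, Real.norm_of_nonneg hpos.le] at hmain
      -- Thus `r` is the reciprocal of `|h'(0)|` for `h = g ∘ diskMobius (-ζ)`.
      have hr1 : r * (‖deriv g ζ‖ * (1 - ‖ζ‖ ^ 2)) = 1 := by
        rw [← mul_assoc, hr, one_div, inv_mul_cancel₀ hpos.ne']
      have h3 := mul_le_mul_of_nonneg_left hmain hr0.le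
      have h4 : r * (‖deriv (deriv f) (g ζ) / deriv f (g ζ)‖ *
          (‖deriv g ζ‖ * (1 - ‖ζ‖ ^ 2))) = ‖deriv (deriv f) (g ζ) / deriv f (g ζ)‖ := by
        linear_combination ‖deriv (deriv f) (g ζ) / deriv f (g ζ)‖ * hr1
      rw [h4] at h3
      linarith
  linarith
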